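/- Let $\mathbb T=\mathbb R/\mathbb Z$, let $\mathrm{Diff}^1_+(\mathbb T)$ be the space of orientation-preserving $C^1$ diffeomorphisms of $\mathbb T$ with the Borel $\sigma$-algebra of the $C^1$ topology, and let $C_0(\mathbb T)$ (resp. $C_0([0,1])$) be the space of real continuous functions on $\mathbb T$ (resp. on $[0,1]$) vanishing at $0$, with the uniform norm. For $\sigma>0$ let $\mathcal W_\sigma$ be the Wiener measure of parameter $\sigma$ on $C_0([0,1])$, that is, the law of a continuous process starting at $0$ with independent increments, the increment from $s$ to $t\ge s$ being a centred Gaussian of variance $\sigma(t-s)$. Let $\mathcal W_{0,\sigma}$ be its image under $C_0([0,1])\to C_0(\mathbb T)$, $y\mapsto (t\mapsto y(t)-t\,y(1))$ (the law of a Brownian bridge), and let the Malliavin--Shavgulidze measure $\mu_\sigma$ on $\mathrm{Diff}^1_+(\mathbb T)$ be the image of $\mathcal W_{0,\sigma}\otimes\mathrm{Leb}$ under the homeomorphism $$C_0(\mathbb T)\times\mathbb T\to \mathrm{Diff}^1_+(\mathbb T),\qquad (x,a)\mapsto\Big(t\mapsto \frac{\int_0^t e^{x(s)}\,ds}{\int_0^1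 e^{x(s)}\,ds}+a\Big).$$ Let $\rho(f)\in\mathbb T$ denote the rotation number of $f$, i.e. the class modulo $1$ of $\lim_{n\to\infty}F^n(0)/n$ for any lift $F:\mathbb R\to\mathbb R$ of $f$. **Proposition.** For every $\sigma>0$ and every irrational number $\alpha$, $$\mu_\sigma\big(\{f\in \mathrm{Diff}^1_+(\mathbb T):\rho(f)=\alpha \bmod 1\}\big)=0 .$$ -/

import Mathlib

open MeasureTheory ProbabilityTheory Filter Topology
open scoped NNReal ENNReal

/-! ### The Wiener measures -/

instance : MeasurableSpace C(unitInterval, ℝ) := borel _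
instance : BorelSpace C(unitInterval, ℝ) := ⟨rfl⟩

/-- Continuous functions on `[0,1]` that vanish at `0`. -/
abbrev WienerSpace : Type := {x : C(unitInterval, ℝ) // x 0 = 0}

/-- `W` is the Wiener measure with parameter `σ` on the Borel sets of `WienerSpace`: under `W` the
increments over successive intervals are independent, and the increment from `s` to `t` is Gaussian
with mean `0` and variance `σ * (t - s)`. -/
structure IsWienerMeasure (σ : ℝ) (W : Measure WienerSpace) : Prop where
  isProbabilityMeasure : IsProbabilityMeasure W
  map_sub : ∀ s t : unitInterval, s ≤ t →
    W.map (fun x => x.1 t - x.1 s) = gaussianReal 0 (σ * ((t : ℝ) - s)).toNNReal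
  hasIndepIncrements : HasIndepIncrements (fun (t : unitInterval) (x : WienerSpace) => x.1 t) W

/-! Existence of the Wiener measures: an isonormal Gaussian process gives a pre-Brownian motion,
which has a continuous modification on `[0,1]`. -/

/-- `h ↦ E[exp(i h)]` is continuous on `L²` of a probability space. -/
theorem continuous_integral_exp_L2 {Ω : Type*} [MeasurableSpace Ω] (P : Measure Ω)
    [IsProbabilityMeasure P] :
    Continuous (fun g : Lp ℝ 2 P => ∫ ω, Complex.exp (g ω * Complex.I) ∂P) := by
  have hint : ∀ g : Lp ℝ 2 P, Integrable (fun ω => Complex.exp (g ω * Complex.I)) P := by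
    intro g
    refine Integrable.of_bound (C := 1) ?_ ?_
    · have := (Lp.aestronglyMeasurable g).aemeasurable
      exact AEMeasurable.aestronglyMeasurable (by fun_prop)
    · exact ae_of_all _ fun ω => by rw [Complex.norm_exp_ofReal_mul_I]
  refine LipschitzWith.continuous (K := 1) (LipschitzWith.of_dist_le_mul fun g h => ?_)
  rw [dist_eq_norm, ← integral_sub (hint g) (hint h), NNReal.coe_one, one_mul, dist_eq_norm]
  have hgh : Integrable (fun ω => (g - h : Lp ℝ 2 P) ω) P :=
    (Lp.memLp (g - h)).integrable (by norm_num)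
  calc ‖∫ ω, (Complex.exp (g ω * Complex.I) - Complex.exp (h ω * Complex.I)) ∂P‖
      ≤ ∫ ω, ‖(g - h : Lp ℝ 2 P) ω‖ ∂P := by
        refine norm_integral_le_of_norm_le hgh.norm ?_
        filter_upwards [Lp.coeFn_sub g h] with ω hω
        rw [hω, Pi.sub_apply]
        have e : Complex.exp (g ω * Complex.I) - Complex.exp (h ω * Complex.I)
            = Complex.exp (h ω * Complex.I) * (Complex.exp (Complex.I * ((g ω - h ω : ℝ))) - 1) := by
          rw [mul_sub, ← Complex.exp_add, mul_one]
          congr 2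
          push_cast; ring
        rw [e, norm_mul, Complex.norm_exp_ofReal_mul_I, one_mul]
        exact Real.norm_exp_I_mul_ofReal_sub_one_le
    _ = (eLpNorm (g - h : Lp ℝ 2 P) 1 P).toReal := by
        rw [eLpNorm_one_eq_lintegral_enorm, integral_norm_eq_lintegral_enorm hgh.1]
    _ ≤ (eLpNorm (g - h : Lp ℝ 2 P) 2 P).toReal := by
        refine ENNReal.toReal_mono (Lp.eLpNorm_ne_top _) ?_
        exact eLpNorm_le_eLpNorm_of_exponent_le (by norm_num) hgh.1
    _ = ‖g - h‖ := by rw [Lp.norm_def]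

/-- Every real Hilbert space carries an isonormal Gaussian process. -/
theorem exists_isonormal (H : Type) [NormedAddCommGroup H] [InnerProductSpace ℝ H]
    [CompleteSpace H] :
    ∃ (Ω : Type) (_ : MeasurableSpace Ω) (P : Measure Ω) (_ : IsProbabilityMeasure P)
      (T : H →ₗᵢ[ℝ] Lp ℝ 2 P), ∀ h, P.map (T h) = gaussianReal 0 (‖h‖₊ ^ 2) := by
  classical
  obtain ⟨w, b, -⟩ := exists_hilbertBasis ℝ H
  let P : Measure (w → ℝ) := Measure.infinitePi (fun _ : w => gaussianReal 0 1)
  have hmp : ∀ i : w, MeasurePreserving (Function.eval i) P (gaussianReal 0 1) := fun i =>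
    measurePreserving_eval_infinitePi _ i
  have hmem : ∀ i : w, MemLp (fun ω : w → ℝ => ω i) 2 P := fun i =>
    (memLp_id_gaussianReal 2).comp_measurePreserving (hmp i)
  have hind : iIndepFun (fun (i : w) (ω : w → ℝ) => ω i) P :=
    iIndepFun_infinitePi (P := fun _ : w => gaussianReal 0 1) (X := fun _ x => x) (fun _ => measurable_id)
  let Z : w → Lp ℝ 2 P := fun i => (hmem i).toLp _
  have hmean : ∀ i : w, ∫ ω, ω i ∂P = 0 := by
    intro i
    have := integral_map (μ := P) (φ := Function.eval i) (f := fun x : ℝ => x)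
      (hmp i).aemeasurable (by fun_prop)
    rw [(hmp i).map_eq, integral_id_gaussianReal] at this
    exact this.symm
  have hZ : Orthonormal ℝ Z := by
    rw [orthonormal_iff_ite]
    intro i j
    have h1 : inner ℝ (Z i) (Z j) = ∫ ω, ω i * ω j ∂P := by
      rw [L2.inner_def]
      refine integral_congr_ae ?_
      filter_upwards [(hmem i).coeFn_toLp, (hmem j).coeFn_toLp] with ω h1 h2
      simp only [Z, h1, h2]
      simp [mul_comm]
    rw [h1]
    split_ifs with hij
    · subst hij
      have h2 := integral_map (μ := P) (φ := Function.eval i) (f := fun x : ℝ => x * x)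
        (hmp i).aemeasurable (by fun_prop)
      rw [(hmp i).map_eq] at h2
      have h3 := variance_fun_id_gaussianReal (μ := 0) (v := 1)
      rw [variance_eq_integral (by fun_prop)] at h3
      simp only [integral_id_gaussianReal, sub_zero, NNReal.coe_one, sq] at h3
      rw [← h3, h2]
    · have := (hind.indepFun hij).integral_mul_eq_mul_integral
        (hmem i).1 (hmem j).1
      simpa [hmean] using this
  let T : H →ₗᵢ[ℝ] Lp ℝ 2 P :=
    (hZ.orthogonalFamily.linearIsometry).comp b.repr.toLinearIsometry
  let a : H → w → ℝ := fun h i => inner ℝ (b i) h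
  have hsum : ∀ h, HasSum (fun i => a h i • Z i) (T h) := by
    intro h
    have := hZ.orthogonalFamily.hasSum_linearIsometry (b.repr h)
    simp only [LinearIsometry.toSpanSingleton_apply] at this
    simp only [b.repr_apply_apply] at this
    exact this
  have hφ : ∀ h, ∫ ω, Complex.exp (T h ω * Complex.I) ∂P = Complex.exp (-(‖h‖ ^ 2 / 2 : ℝ)) := by
    intro h
    have h1 := ((continuous_integral_exp_L2 P).tendsto (T h)).comp (hsum h)
    have hb : HasSum (fun i => (a h i) ^ 2) (‖h‖ ^ 2) := by
      have := b.hasSum_inner_mul_inner h h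
      rw [real_inner_self_eq_norm_sq] at this
      have e : (fun i => inner ℝ h (b i) * inner ℝ (b i) h) = fun i => (a h i) ^ 2 := by
        funext i
        rw [real_inner_comm, sq]
      rwa [e] at this
    have h2 : Tendsto (fun F : Finset w => Complex.exp (-((∑ i ∈ F, (a h i) ^ 2) / 2 : ℝ)))
        atTop (𝓝 (Complex.exp (-(‖h‖ ^ 2 / 2 : ℝ)))) := by
      have hc : Continuous (fun x : ℝ => Complex.exp (-(x / 2 : ℝ))) := by fun_prop
      exact (hc.tendsto _).comp hb
    refine tendsto_nhds_unique h1 (h2.congr fun F => ?_)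
    have hXm : ∀ i ∈ F, AEMeasurable (fun ω : w → ℝ => a h i * ω i) P := fun i _ =>
      ((measurable_pi_apply i).const_mul _).aemeasurable
    have hXi : iIndepFun (F.restrict (fun i (ω : w → ℝ) => a h i * ω i)) P :=
      (hind.comp (fun i x => a h i * x) (fun i => by fun_prop)).restrict F
    have h3 := congrFun (hXi.charFun_map_fun_finsetSum_eq_prod hXm) 1
    rw [Finset.prod_apply, charFun_apply_real, integral_map (by fun_prop) (by fun_prop)] at h3
    have h4 : ∀ i, charFun (P.map (fun ω : w → ℝ => a h i * ω i)) 1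
        = Complex.exp (-((a h i) ^ 2 / 2 : ℝ)) := by
      intro i
      have : P.map (fun ω : w → ℝ => a h i * ω i)
          = (gaussianReal 0 1).map (fun x => a h i * x) := by
        rw [← (hmp i).map_eq, Measure.map_map (by fun_prop) (by fun_prop)]; rfl
      rw [this, gaussianReal_map_const_mul, charFun_gaussianReal]
      congr 1
      simp
    simp only [h4] at h3
    rw [← Complex.exp_sum] at h3
    have h5 : Complex.exp (-((∑ i ∈ F, (a h i) ^ 2) / 2 : ℝ))
        = Complex.exp (∑ i ∈ F, (((-((a h i) ^ 2 / 2 : ℝ)) : ℂ))) := by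
      congr 1
      push_cast
      rw [Finset.sum_div, Finset.sum_neg_distrib]
    rw [h5, ← h3]
    refine integral_congr_ae ?_
    have hall : ∀ᵐ ω ∂P, ∀ i ∈ F, Z i ω = ω i :=
      (Finset.eventually_all F).2 fun i _ => (hmem i).coeFn_toLp
    have hs : ∀ G : Finset w, ∀ᵐ ω ∂P,
        (∑ i ∈ G, a h i • Z i : Lp ℝ 2 P) ω = ∑ i ∈ G, a h i * Z i ω := by
      intro G
      induction G using Finset.induction with
      | empty =>
        simp only [Finset.sum_empty]
        exact Lp.coeFn_zero ℝ 2 P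
      | insert i G hi ih =>
        rw [Finset.sum_insert hi]
        filter_upwards [ih, Lp.coeFn_add (a h i • Z i) (∑ i ∈ G, a h i • Z i),
          Lp.coeFn_smul (a h i) (Z i)] with ω h1 h2 h3
        rw [h2, Pi.add_apply, h1, h3, Finset.sum_insert hi]
        rfl
    filter_upwards [hall, hs F] with ω h1 h2
    change Complex.exp _ = Complex.exp (((∑ i ∈ F, a h i • Z i : Lp ℝ 2 P) ω : ℂ) * Complex.I)
    rw [h2, Finset.sum_congr rfl fun i hi => show a h i * Z i ω = a h i * ω i by rw [h1 i hi]]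
    simp
  refine ⟨w → ℝ, inferInstance, P, inferInstance, T, fun h => ?_⟩
  have : IsProbabilityMeasure (P.map (T h)) :=
    Measure.isProbabilityMeasure_map (Lp.aestronglyMeasurable _).aemeasurable
  refine Measure.ext_of_charFun ?_
  ext u
  rw [charFun_gaussianReal, charFun_apply_real, integral_map
    (Lp.aestronglyMeasurable _).aemeasurable (by fun_prop)]
  have := hφ (u • h)
  rw [map_smul] at this
  have e : ∫ ω, Complex.exp (u * T h ω * Complex.I) ∂P
      = ∫ ω, Complex.exp ((u • T h : Lp ℝ 2 P) ω * Complex.I) ∂P := by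
    refine integral_congr_ae ?_
    filter_upwards [Lp.coeFn_smul u (T h)] with ω hω
    rw [hω]; simp
  rw [e, this]
  congr 1
  rw [norm_smul]
  simp [mul_pow]
  ring

theorem exists_isPreBrownianReal :
    ∃ (Ω : Type) (_ : MeasurableSpace Ω) (P : Measure Ω) (_ : IsProbabilityMeasure P)
      (X : ℝ≥0 → Ω → ℝ), (∀ t, Measurable (X t)) ∧ IsPreBrownianReal X P := by
  obtain ⟨Ω, mΩ, P, hP, T, hT⟩ := exists_isonormal (Lp ℝ 2 (volume : Measure ℝ))
  let e : ℝ≥0 → Lp ℝ 2 (volume : Measure ℝ) := fun t =>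
    indicatorConstLp 2 (measurableSet_Ioc (a := (0 : ℝ)) (b := t)) (by simp) (1 : ℝ)
  have he : ∀ s t, s ≤ t → inner ℝ (e s) (e t) = (s : ℝ) := by
    intro s t hst
    have : Set.Ioc (0 : ℝ) s ∩ Set.Ioc (0 : ℝ) t = Set.Ioc 0 (s : ℝ) := by
      rw [Set.Ioc_inter_Ioc]; simp [hst]
    simp [e, L2.inner_indicatorConstLp_indicatorConstLp, this]
  have hTm : ∀ h, AEMeasurable (T h) P := fun h => (Lp.aestronglyMeasurable _).aemeasurable
  have hmean : ∀ h, ∫ ω, T h ω ∂P = 0 := by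
    intro h
    have := integral_map (μ := P) (φ := T h) (f := fun x : ℝ => x) (hTm h) (by fun_prop)
    rw [hT, integral_id_gaussianReal] at this
    exact this.symm
  have hpre : IsPreBrownianReal (fun t => (T (e t) : Ω → ℝ)) P := by
    refine IsGaussianProcess.isPreBrownianReal_of_covariance ⟨fun I => ⟨⟨fun L => ?_⟩⟩⟩
      (fun t => hmean _) ?_
    · classical
      have hm : AEMeasurable (fun ω => I.restrict (fun t => T (e t) ω)) P :=
        aemeasurable_pi_lambda _ fun i => hTm _
      let h : Lp ℝ 2 (volume : Measure ℝ) := ∑ i : I, L (Pi.single i 1) • e i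
      have hL : (L ∘ fun ω => I.restrict (fun t => T (e t) ω)) =ᵐ[P] T h := by
        have hs : ∀ G : Finset I, ∀ᵐ ω ∂P, T (∑ i ∈ G, L (Pi.single i 1) • e i) ω
            = ∑ i ∈ G, L (Pi.single i 1) * T (e i) ω := by
          intro G
          induction G using Finset.induction with
          | empty =>
            simp only [Finset.sum_empty, map_zero]
            exact Lp.coeFn_zero ℝ 2 P
          | insert i G hi ih =>
            rw [Finset.sum_insert hi, map_add, map_smul]
            filter_upwards [ih, Lp.coeFn_add (L (Pi.single i 1) • T (e i))
              (T (∑ i ∈ G, L (Pi.single i 1) • e i)),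
              Lp.coeFn_smul (L (Pi.single i 1)) (T (e i))] with ω h1 h2 h3
            rw [h2, Pi.add_apply, h1, h3, Finset.sum_insert hi]
            rfl
        filter_upwards [hs Finset.univ] with ω hω
        rw [hω, Function.comp_apply]
        conv_lhs => rw [pi_eq_sum_univ' (I.restrict (fun t => T (e t) ω)), map_sum]
        refine Finset.sum_congr rfl fun i _ => ?_
        rw [map_smul, smul_eq_mul, mul_comm]
        congr 2
      have hmap : (P.map (fun ω => I.restrict (fun t => T (e t) ω))).map L
          = gaussianReal 0 (‖h‖₊ ^ 2) := by
        rw [AEMeasurable.map_map_of_aemeasurable (by fun_prop) hm, Measure.map_congr hL, hT]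
      have h1 : (P.map (fun ω => I.restrict (fun t => T (e t) ω)))[L] = 0 := by
        have := integral_map (μ := P.map (fun ω => I.restrict (fun t => T (e t) ω)))
          (φ := L) (f := fun x : ℝ => x) (by fun_prop) (by fun_prop)
        rw [hmap, integral_id_gaussianReal] at this
        exact this.symm
      have h2 : Var[L; P.map (fun ω => I.restrict (fun t => T (e t) ω))]
          = ((‖h‖₊ ^ 2 : ℝ≥0) : ℝ) := by
        have := variance_map (μ := P.map (fun ω => I.restrict (fun t => T (e t) ω)))
          (X := (id : ℝ → ℝ)) (Y := L) (by fun_prop) (by fun_prop)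
        rw [hmap, variance_id_gaussianReal] at this
        exact this.symm
      rw [hmap, h1, h2, Real.toNNReal_coe]
    · intro s t hst
      rw [covariance_eq_sub (Lp.memLp _) (Lp.memLp _), hmean, hmean, mul_zero, sub_zero,
        ← he s t hst, ← T.inner_map_map, L2.inner_def]
      refine integral_congr_ae (ae_of_all _ fun ω => ?_)
      exact mul_comm _ _
  refine ⟨Ω, mΩ, P, hP, fun t => (hTm (e t)).mk _, fun t => (hTm (e t)).measurable_mk, ?_⟩
  exact hpre.congr fun t => (hTm (e t)).ae_eq_mk

theorem exists_continuous_limit (x : ℝ≥0 → ℝ) (K : ℝ)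
    (hx : ∀ n k : ℕ, k < 2 ^ n →
      |x ((k + 1 : ℕ) / 2 ^ n) - x (k / 2 ^ n)| ≤ K * (7 / 8) ^ n) :
    ∃ f : C(unitInterval, ℝ), ∀ t : unitInterval,
      Tendsto (fun n : ℕ => x (⌊(t : ℝ) * 2 ^ n⌋₊ / 2 ^ n)) atTop (𝓝 (f t)) := by
  let S : ℕ → unitInterval → ℝ := fun n t => x (⌊(t : ℝ) * 2 ^ n⌋₊ / 2 ^ n)
  have hK : 0 ≤ K := by simpa using (abs_nonneg _).trans (hx 0 0 (by simp))
  have hstep : ∀ (t : unitInterval) n, dist (S n t) (S (n + 1) t) ≤ K * (7 / 8) ^ n := by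
    intro t n
    have h0 : 0 ≤ (t : ℝ) * 2 ^ n := mul_nonneg t.2.1 (by positivity)
    have h1 : 0 ≤ (t : ℝ) * 2 ^ (n + 1) := mul_nonneg t.2.1 (by positivity)
    have ha := Nat.floor_le h0
    have hb := Nat.lt_floor_add_one ((t : ℝ) * 2 ^ n)
    have hc := Nat.floor_le h1
    have hd := Nat.lt_floor_add_one ((t : ℝ) * 2 ^ (n + 1))
    set m := ⌊(t : ℝ) * 2 ^ n⌋₊ with hm
    set p := ⌊(t : ℝ) * 2 ^ (n + 1)⌋₊ with hp
    have e : (t : ℝ) * 2 ^ (n + 1) = 2 * ((t : ℝ) * 2 ^ n) := by ring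
    rw [e] at hc hd
    have l1 : 2 * m < p + 1 := by
      have : ((2 * m : ℕ) : ℝ) < ((p + 1 : ℕ) : ℝ) := by push_cast; linarith
      exact_mod_cast this
    have l2 : p < 2 * m + 2 := by
      have : ((p : ℕ) : ℝ) < ((2 * m + 2 : ℕ) : ℝ) := by push_cast; linarith
      exact_mod_cast this
    have e2 : (m : ℝ≥0) / 2 ^ n = ((2 * m : ℕ) : ℝ≥0) / 2 ^ (n + 1) := by
      push_cast; rw [pow_succ]; field_simp
    have hS1 : S n t = x (((2 * m : ℕ) : ℝ≥0) / 2 ^ (n + 1)) := by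
      rw [← e2]
    have hS2 : S (n + 1) t = x ((p : ℝ≥0) / 2 ^ (n + 1)) := rfl
    rw [hS1, hS2, dist_comm, Real.dist_eq]
    obtain h | h : p = 2 * m ∨ p = 2 * m + 1 := by omega
    · rw [h, sub_self, abs_zero]; positivity
    · have hlt : 2 * m < 2 ^ (n + 1) := by
        have ht : (t : ℝ) * 2 ^ n ≤ 2 ^ n := mul_le_of_le_one_left (by positivity) t.2.2
        have : ((2 * m + 1 : ℕ) : ℝ) ≤ ((2 ^ (n + 1) : ℕ) : ℝ) := by
          rw [← h]; push_cast; rw [pow_succ]; linarith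
        have := Nat.cast_le.1 this
        omega
      rw [h]
      refine (hx (n + 1) (2 * m) hlt).trans ?_
      rw [pow_succ]
      have : (0 : ℝ) ≤ K * (7 / 8) ^ n := by positivity
      nlinarith
  have hlim : ∀ t, ∃ l, Tendsto (fun n => S n t) atTop (𝓝 l) := fun t =>
    cauchySeq_tendsto_of_complete
      (cauchySeq_of_le_geometric (7 / 8) K (by norm_num) (hstep t))
  choose f hf using hlim
  have hdist : ∀ t n, |S n t - f t| ≤ 8 * K * (7 / 8) ^ n := by
    intro t n
    have := dist_le_of_le_geometric_of_tendsto (7 / 8) K (by norm_num) (hstep t) (hf t) n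
    rw [Real.dist_eq] at this
    refine this.trans (le_of_eq ?_)
    norm_num; ring
  have hosc : ∀ n, ∀ s t : unitInterval, s ≤ t → (t : ℝ) - s ≤ 1 / 2 ^ n →
      |f t - f s| ≤ 17 * K * (7 / 8) ^ n := by
    intro n s t hst hd
    have hst' : (s : ℝ) ≤ t := hst
    have hpos : (0 : ℝ) < 2 ^ n := by positivity
    have h0 : 0 ≤ (s : ℝ) * 2 ^ n := mul_nonneg s.2.1 (by positivity)
    have hmono : ⌊(s : ℝ) * 2 ^ n⌋₊ ≤ ⌊(t : ℝ) * 2 ^ n⌋₊ :=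
      Nat.floor_le_floor (by gcongr)
    have hle : ⌊(t : ℝ) * 2 ^ n⌋₊ ≤ ⌊(s : ℝ) * 2 ^ n⌋₊ + 1 := by
      rw [← Nat.floor_add_one h0]
      refine Nat.floor_le_floor ?_
      rw [le_div_iff₀ hpos] at hd
      linarith
    have hSS : |S n t - S n s| ≤ K * (7 / 8) ^ n := by
      obtain h | h : ⌊(t : ℝ) * 2 ^ n⌋₊ = ⌊(s : ℝ) * 2 ^ n⌋₊ ∨
          ⌊(t : ℝ) * 2 ^ n⌋₊ = ⌊(s : ℝ) * 2 ^ n⌋₊ + 1 := by omega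
      · simp only [S, h, sub_self, abs_zero]; positivity
      · have hlt : ⌊(s : ℝ) * 2 ^ n⌋₊ < 2 ^ n := by
          have ht : (t : ℝ) * 2 ^ n ≤ 2 ^ n := mul_le_of_le_one_left (by positivity) t.2.2
          have h2 := Nat.floor_le (mul_nonneg t.2.1 hpos.le)
          have : ((⌊(s : ℝ) * 2 ^ n⌋₊ + 1 : ℕ) : ℝ) ≤ ((2 ^ n : ℕ) : ℝ) := by
            rw [← h]; push_cast; exact h2.trans ht
          have := Nat.cast_le.1 this
          omega
        have := hx n _ hlt
        simp only [S, h]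
        exact this
    have h1 := abs_le.1 (hdist t n)
    have h2 := abs_le.1 (hdist s n)
    have h3 := abs_le.1 hSS
    rw [abs_le]; constructor <;> linarith [h1.1, h1.2, h2.1, h2.2, h3.1, h3.2]
  refine ⟨⟨f, ?_⟩, hf⟩
  rw [Metric.continuous_iff]
  intro s ε hε
  have ht : Tendsto (fun n : ℕ => 17 * K * (7 / 8 : ℝ) ^ n) atTop (𝓝 (17 * K * 0)) :=
    (tendsto_pow_atTop_nhds_zero_of_lt_one (by norm_num) (by norm_num)).const_mul _
  rw [mul_zero] at ht
  obtain ⟨n, hn⟩ := (ht.eventually (gt_mem_nhds hε)).exists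
  refine ⟨1 / 2 ^ n, by positivity, fun t hts => ?_⟩
  rw [Subtype.dist_eq, Real.dist_eq, abs_lt] at hts
  rw [Real.dist_eq]
  rcases le_total s t with h | h
  · exact (hosc n s t h (by linarith [hts.2])).trans_lt hn
  · rw [abs_sub_comm]
    exact (hosc n t s h (by linarith [hts.1])).trans_lt hn

theorem aemeasurable_continuousMap {Ω : Type*} [MeasurableSpace Ω] {P : Measure Ω}
    {Y : Ω → C(unitInterval, ℝ)} (hY : ∀ t, AEMeasurable (fun ω => Y ω t) P) :
    AEMeasurable Y P := by
  refine aemeasurable_of_tendsto_metrizable_ae atTop (f := fun n ω => bernsteinApproximation n (Y ω))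
    (fun n => ?_) (ae_of_all _ fun ω => bernsteinApproximation_uniform (Y ω))
  have h : ∀ k : Fin (n + 1), Continuous fun y : ℝ =>
      (bernstein n k • ContinuousMap.const unitInterval y : C(unitInterval, ℝ)) := fun k =>
    continuous_const.mul ContinuousMap.continuous_const'
  unfold bernsteinApproximation
  exact Finset.aemeasurable_fun_sum _ fun k _ => (h k).measurable.comp_aemeasurable (hY _)

theorem lintegral_gaussian_fourth (v : ℝ≥0) :
    ∫⁻ y, ENNReal.ofReal (y ^ 4) ∂(gaussianReal 0 v)
      = (v : ℝ≥0∞) ^ 2 * ∫⁻ y, ENNReal.ofReal (y ^ 4) ∂(gaussianReal 0 1) := by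
  have : gaussianReal 0 v = (gaussianReal 0 1).map (fun x => √(v : ℝ) * x) := by
    rw [gaussianReal_map_const_mul]
    congr 1
    · simp
    · ext; simp
  rw [this, lintegral_map (by fun_prop) (by fun_prop), ← lintegral_const_mul _ (by fun_prop)]
  refine lintegral_congr fun y => ?_
  have h : (√(v : ℝ) * y) ^ 4 = (v : ℝ) ^ 2 * y ^ 4 := by
    have := Real.sq_sqrt (NNReal.coe_nonneg v)
    calc (√(v : ℝ) * y) ^ 4 = (√(v : ℝ) ^ 2) ^ 2 * y ^ 4 := by ring
      _ = _ := by rw [this]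
  rw [h, ENNReal.ofReal_mul (by positivity)]
  congr 1
  rw [ENNReal.ofReal_pow (NNReal.coe_nonneg v), ENNReal.ofReal_coe_nnreal]

theorem lintegral_gaussian_fourth_ne_top :
    ∫⁻ y, ENNReal.ofReal (y ^ 4) ∂(gaussianReal 0 1) ≠ ∞ := by
  have h := (memLp_id_gaussianReal (μ := 0) (v := 1) 4).integrable_norm_pow (by norm_num)
  have h2 := (hasFiniteIntegral_iff_enorm.1 h.2).ne
  convert h2 using 3 with y
  rw [← ofReal_norm]
  congr 1
  simp [(by decide : Even 4).pow_abs]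

theorem exists_continuous_modification {Ω : Type} [MeasurableSpace Ω] {P : Measure Ω}
    {X : ℝ≥0 → Ω → ℝ} (hXm : ∀ t, Measurable (X t))
    (hX : IsPreBrownianReal X P) :
    ∃ Y : Ω → C(unitInterval, ℝ), (∀ ω, Y ω 0 = 0) ∧
      ∀ t : unitInterval, ∀ᵐ ω ∂P, Y ω t = X ⟨t, t.2.1⟩ ω := by
  have hsub : ∀ s t : ℝ≥0, s ≤ t → P.map (X t - X s) = gaussianReal 0 (t - s) := by
    intro s t hst
    rw [(hX.hasLaw_sub t s).map_eq]
    congr 1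
    ext
    have hst' : (s : ℝ) ≤ t := hst
    rw [coe_nndist, NNReal.coe_sub hst, Real.dist_eq]
    exact abs_of_nonneg (sub_nonneg.2 hst')
  have hmeas : ∀ s t : ℝ≥0, Measurable (X t - X s) := fun s t => (hXm t).sub (hXm s)
  -- the increments along the dyadic grids decay geometrically
  have hinc : ∀ᵐ ω ∂P, ∃ K : ℝ, ∀ n k : ℕ, k < 2 ^ n →
      |X ((k + 1 : ℕ) / 2 ^ n) ω - X (k / 2 ^ n) ω| ≤ K * (7 / 8) ^ n := by
    let C := ∫⁻ y, ENNReal.ofReal (y ^ 4) ∂(gaussianReal 0 1)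
    let V : ℕ → Ω → ℝ≥0∞ := fun n ω => ∑ k ∈ Finset.range (2 ^ n),
      ENNReal.ofReal ((8 / 7) ^ (4 * n)) *
        ENNReal.ofReal ((X ((k + 1 : ℕ) / 2 ^ n) ω - X (k / 2 ^ n) ω) ^ 4)
    have hm1 : ∀ n k : ℕ, Measurable fun ω =>
        ENNReal.ofReal ((X ((k + 1 : ℕ) / 2 ^ n) ω - X (k / 2 ^ n) ω) ^ 4) := fun n k =>
      ENNReal.measurable_ofReal.comp (((hXm _).sub (hXm _)).pow_const 4)
    have hVm : ∀ n, Measurable (V n) := fun n =>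
      Finset.measurable_fun_sum _ fun k _ => (hm1 n k).const_mul _
    have hV : ∀ n, ∫⁻ ω, V n ω ∂P = ENNReal.ofReal ((2048 / 2401) ^ n) * C := by
      intro n
      have hk : ∀ k : ℕ, ∫⁻ ω, ENNReal.ofReal ((X ((k + 1 : ℕ) / 2 ^ n) ω - X (k / 2 ^ n) ω) ^ 4) ∂P
          = ENNReal.ofReal ((1 / 4) ^ n) * C := by
        intro k
        have h1 := hsub (k / 2 ^ n) ((k + 1 : ℕ) / 2 ^ n) (by gcongr; simp)
        have h2 := lintegral_map (μ := P) (f := fun y : ℝ => ENNReal.ofReal (y ^ 4))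
          (by fun_prop) (hmeas (k / 2 ^ n) ((k + 1 : ℕ) / 2 ^ n))
        rw [h1, lintegral_gaussian_fourth] at h2
        refine h2.symm.trans ?_
        congr 1
        have : ((k + 1 : ℕ) / 2 ^ n - k / 2 ^ n : ℝ≥0) = 1 / 2 ^ n := by
          rw [← tsub_div]; simp
        rw [this, ← ENNReal.ofReal_coe_nnreal, ← ENNReal.ofReal_pow (by positivity)]
        congr 1
        push_cast
        rw [div_pow, div_pow, ← pow_mul, mul_comm n 2, pow_mul]
        norm_num
      simp only [V]
      rw [lintegral_finsetSum _ (fun k _ => (hm1 n k).const_mul _)]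
      simp_rw [lintegral_const_mul _ (hm1 n _), hk]
      rw [Finset.sum_const, Finset.card_range, nsmul_eq_mul, ← mul_assoc, ← mul_assoc]
      congr 1
      rw [show ((2 ^ n : ℕ) : ℝ≥0∞) = ENNReal.ofReal (2 ^ n) by
        rw [← ENNReal.ofReal_natCast]; push_cast; rfl,
        ← ENNReal.ofReal_mul (by positivity), ← ENNReal.ofReal_mul (by positivity)]
      congr 1
      rw [pow_mul, ← mul_pow, ← mul_pow]
      norm_num
    have hfin : ∫⁻ ω, ∑' n, V n ω ∂P ≠ ∞ := by
      rw [lintegral_tsum fun n => (hVm n).aemeasurable]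
      simp_rw [hV]
      rw [ENNReal.tsum_mul_right]
      refine ENNReal.mul_ne_top ?_ lintegral_gaussian_fourth_ne_top
      exact (summable_geometric_of_lt_one (by norm_num) (by norm_num)).tsum_ofReal_ne_top
    have hae := ae_lt_top (Measurable.tsum hVm) hfin
    filter_upwards [hae] with ω hω
    set A := (∑' n, V n ω).toReal with hA
    have hA0 : 0 ≤ A := ENNReal.toReal_nonneg
    refine ⟨A + 1, fun n k hk => ?_⟩
    have h1 : ENNReal.ofReal ((8 / 7) ^ (4 * n)) *
        ENNReal.ofReal ((X ((k + 1 : ℕ) / 2 ^ n) ω - X (k / 2 ^ n) ω) ^ 4) ≤ ENNReal.ofReal A := by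
      rw [hA, ENNReal.ofReal_toReal hω.ne]
      refine le_trans ?_ (ENNReal.le_tsum n)
      exact Finset.single_le_sum (f := fun k : ℕ => ENNReal.ofReal ((8 / 7) ^ (4 * n)) *
        ENNReal.ofReal ((X ((k + 1 : ℕ) / 2 ^ n) ω - X (k / 2 ^ n) ω) ^ 4))
        (fun _ _ => zero_le) (Finset.mem_range.2 hk)
    rw [← ENNReal.ofReal_mul (by positivity), ENNReal.ofReal_le_ofReal_iff hA0] at h1
    set D := X ((k + 1 : ℕ) / 2 ^ n) ω - X (k / 2 ^ n) ω
    have h2 : ((8 / 7) ^ n * |D|) ^ 4 ≤ (A + 1) ^ 4 := by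
      calc ((8 / 7) ^ n * |D|) ^ 4 = (8 / 7) ^ (4 * n) * D ^ 4 := by
            rw [mul_pow, ← pow_mul, mul_comm n 4, (by decide : Even 4).pow_abs]
        _ ≤ A := h1
        _ ≤ A + 1 := by linarith
        _ ≤ (A + 1) ^ 4 := le_self_pow₀ (by linarith) (by norm_num)
    have h3 := le_of_pow_le_pow_left₀ (by norm_num) (by linarith) h2
    have h4 : (7 / 8 : ℝ) ^ n * (8 / 7) ^ n = 1 := by rw [← mul_pow]; norm_num
    calc |D| = (7 / 8) ^ n * ((8 / 7) ^ n * |D|) := by rw [← mul_assoc, h4, one_mul]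
      _ ≤ (7 / 8) ^ n * (A + 1) := by gcongr
      _ = _ := mul_comm _ _
  -- the values at dyadic approximations converge almost surely
  have hconv : ∀ t : unitInterval, ∀ᵐ ω ∂P, Tendsto
      (fun n : ℕ => X (⌊(t : ℝ) * 2 ^ n⌋₊ / 2 ^ n) ω) atTop (𝓝 (X ⟨t, t.2.1⟩ ω)) := by
    intro t
    let d : ℕ → ℝ≥0 := fun n => ⌊(t : ℝ) * 2 ^ n⌋₊ / 2 ^ n
    let t' : ℝ≥0 := ⟨t, t.2.1⟩
    have hd : ∀ n, d n ≤ t' ∧ t' - d n ≤ (1 / 2) ^ n := by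
      intro n
      have hpos : (0 : ℝ) < 2 ^ n := by positivity
      have h1 := Nat.floor_le (mul_nonneg t.2.1 hpos.le)
      have h2 := Nat.lt_floor_add_one ((t : ℝ) * 2 ^ n)
      constructor
      · rw [← NNReal.coe_le_coe]
        simp only [d, t']
        push_cast
        rw [div_le_iff₀ hpos]
        exact h1
      · rw [tsub_le_iff_right, ← NNReal.coe_le_coe]
        simp only [d, t']
        push_cast
        rw [one_div, inv_pow, inv_eq_one_div, ← add_div, le_div_iff₀ hpos]
        change (t : ℝ) * 2 ^ n ≤ _
        linarith
    let V : ℕ → Ω → ℝ≥0∞ := fun n ω => ENNReal.ofReal ((X t' ω - X (d n) ω) ^ 4)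
    have hVm : ∀ n, Measurable (V n) := fun n =>
      ENNReal.measurable_ofReal.comp (((hXm _).sub (hXm _)).pow_const 4)
    let C := ∫⁻ y, ENNReal.ofReal (y ^ 4) ∂(gaussianReal 0 1)
    have hV : ∀ n, ∫⁻ ω, V n ω ∂P ≤ ENNReal.ofReal ((1 / 4) ^ n) * C := by
      intro n
      have h1 := hsub (d n) t' (hd n).1
      have h2 := lintegral_map (μ := P) (f := fun y : ℝ => ENNReal.ofReal (y ^ 4))
        (by fun_prop) (hmeas (d n) t')
      rw [h1, lintegral_gaussian_fourth] at h2
      refine h2.symm.trans_le ?_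
      gcongr
      rw [← ENNReal.ofReal_coe_nnreal, ← ENNReal.ofReal_pow (by positivity)]
      refine ENNReal.ofReal_le_ofReal ?_
      have h3 : ((t' - d n : ℝ≥0) : ℝ) ≤ (1 / 2) ^ n := by
        have := NNReal.coe_le_coe.2 (hd n).2
        push_cast at this
        exact this
      calc ((t' - d n : ℝ≥0) : ℝ) ^ 2 ≤ ((1 / 2) ^ n) ^ 2 := by gcongr
        _ = (1 / 4) ^ n := by rw [← pow_mul, mul_comm, pow_mul]; norm_num
    have hfin : ∫⁻ ω, ∑' n, V n ω ∂P ≠ ∞ := by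
      rw [lintegral_tsum fun n => (hVm n).aemeasurable]
      refine ne_top_of_le_ne_top ?_ (ENNReal.tsum_le_tsum hV)
      rw [ENNReal.tsum_mul_right]
      refine ENNReal.mul_ne_top ?_ lintegral_gaussian_fourth_ne_top
      exact (summable_geometric_of_lt_one (by norm_num) (by norm_num)).tsum_ofReal_ne_top
    filter_upwards [ae_lt_top (Measurable.tsum hVm) hfin] with ω hω
    have h1 := ENNReal.tendsto_atTop_zero_of_tsum_ne_top hω.ne
    have h2 : Tendsto (fun n => (X t' ω - X (d n) ω) ^ 4) atTop (𝓝 0) := by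
      have h3 := (ENNReal.tendsto_toReal ENNReal.zero_ne_top).comp h1
      refine h3.congr fun n => ?_
      exact ENNReal.toReal_ofReal (by positivity)
    rw [tendsto_iff_norm_sub_tendsto_zero]
    refine squeeze_zero' (g := fun n => ((X t' ω - X (d n) ω) ^ 4) ^ (1 / 4 : ℝ))
      (Eventually.of_forall fun n => norm_nonneg _) (Eventually.of_forall fun n => ?_) ?_
    · have : (X t' ω - X (d n) ω) ^ 4 = ‖X (d n) ω - X t' ω‖ ^ 4 := by
        rw [Real.norm_eq_abs, abs_sub_comm, (by decide : Even 4).pow_abs]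
      rw [this]
      have h5 := Real.pow_rpow_inv_natCast (norm_nonneg (X (d n) ω - X t' ω))
        (four_ne_zero (α := ℕ))
      rw [one_div]
      exact h5.symm.le
    · have := h2.rpow_const (p := (1 / 4 : ℝ)) (Or.inr (by norm_num))
      rwa [Real.zero_rpow (by norm_num)] at this
  have hex : ∀ ω, ∃ f : C(unitInterval, ℝ), f 0 = 0 ∧
      (((∃ K : ℝ, ∀ n k : ℕ, k < 2 ^ n →
        |X ((k + 1 : ℕ) / 2 ^ n) ω - X (k / 2 ^ n) ω| ≤ K * (7 / 8) ^ n) ∧ X 0 ω = 0) →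
      ∀ t : unitInterval, Tendsto
        (fun n : ℕ => X (⌊(t : ℝ) * 2 ^ n⌋₊ / 2 ^ n) ω) atTop (𝓝 (f t))) := by
    intro ω
    by_cases h : (∃ K : ℝ, ∀ n k : ℕ, k < 2 ^ n →
        |X ((k + 1 : ℕ) / 2 ^ n) ω - X (k / 2 ^ n) ω| ≤ K * (7 / 8) ^ n) ∧ X 0 ω = 0
    · obtain ⟨⟨K, hK⟩, h0⟩ := h
      obtain ⟨f, hf⟩ := exists_continuous_limit (fun t => X t ω) K hK
      refine ⟨f, ?_, fun _ => hf⟩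
      have := hf 0
      simp only [Set.Icc.coe_zero, zero_mul, Nat.floor_zero, Nat.cast_zero, zero_div, h0] at this
      exact (tendsto_nhds_unique this tendsto_const_nhds)
    · exact ⟨0, rfl, fun h' => absurd h' h⟩
  choose Y hY0 hY using hex
  refine ⟨Y, hY0, fun t => ?_⟩
  filter_upwards [hinc, hX.eval_zero_ae_eq_zero, hconv t] with ω h1 h2 h3
  exact tendsto_nhds_unique (hY ω ⟨h1, h2⟩ t) h3

theorem exists_isWienerMeasure (σ : ℝ) : ∃ W, IsWienerMeasure σ W := by
  obtain ⟨Ω, mΩ, P, hP, X, hXm, hX⟩ := exists_isPreBrownianReal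
  obtain ⟨Y, hY0, hY⟩ := exists_continuous_modification hXm hX
  have hYt : ∀ t, AEMeasurable (fun ω => Y ω t) P := fun t =>
    (hXm _).aemeasurable.congr (EventuallyEq.symm (hY t))
  have hsY : AEMeasurable (fun ω => √σ • Y ω) P :=
    aemeasurable_continuousMap fun t => (hYt t).const_mul _
  let Z : Ω → WienerSpace := fun ω => ⟨√σ • Y ω, by simp [hY0]⟩
  have hZ : AEMeasurable Z P := hsY.subtype_mk
  have hev : ∀ t : unitInterval, Measurable fun x : WienerSpace => x.1 t := fun t =>
    ((continuous_eval_const t).comp continuous_subtype_val).measurable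
  have hZX : ∀ t : unitInterval, ∀ᵐ ω ∂P, (Z ω).1 t = √σ * X ⟨t, t.2.1⟩ ω := fun t => by
    filter_upwards [hY t] with ω hω
    rw [← hω]; rfl
  refine ⟨P.map Z, ⟨Measure.isProbabilityMeasure_map hZ, fun s t hst => ?_, fun n τ hτ => ?_⟩⟩
  · have hm : Measurable fun x : WienerSpace => x.1 t - x.1 s := (hev t).sub (hev s)
    rw [AEMeasurable.map_map_of_aemeasurable hm.aemeasurable hZ]
    have h1 : ((fun x : WienerSpace => x.1 t - x.1 s) ∘ Z) =ᵐ[P]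
        fun ω => √σ * (X ⟨t, t.2.1⟩ - X ⟨s, s.2.1⟩) ω := by
      filter_upwards [hZX s, hZX t] with ω h1 h2
      rw [Function.comp_apply, h1, h2, Pi.sub_apply, mul_sub]
    have h2 := hX.hasLaw_sub ⟨t, t.2.1⟩ ⟨s, s.2.1⟩
    rw [Measure.map_congr h1, (gaussianReal_const_mul h2 √σ).map_eq, mul_zero]
    congr 1
    have hst' : (s : ℝ) ≤ t := hst
    ext
    rw [NNReal.coe_mul, coe_nndist, Real.dist_eq]
    change √σ ^ 2 * |(t : ℝ) - s| = _
    rw [abs_of_nonneg (by linarith)]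
    rcases le_total 0 σ with h | h
    · rw [Real.sq_sqrt h, Real.coe_toNNReal _ (mul_nonneg h (by linarith))]
    · rw [Real.sqrt_eq_zero_of_nonpos h, Real.toNNReal_of_nonpos
        (mul_nonpos_of_nonpos_of_nonneg h (by linarith))]
      simp
  · have h1 := hX.hasIndepIncrements n (fun i => ⟨τ i, (τ i).2.1⟩) (fun i j hij => hτ hij)
    have h2 : iIndepFun (fun (i : Fin n) ω => (Z ω).1 (τ i.succ) - (Z ω).1 (τ i.castSucc)) P := by
      refine (h1.comp (fun _ y => √σ * y) (fun _ => by fun_prop)).congr fun i => ?_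
      filter_upwards [hZX (τ i.succ), hZX (τ i.castSucc)] with ω h1 h2
      rw [h1, h2, Function.comp_apply, mul_sub]
    have hm : ∀ i : Fin n, Measurable fun x : WienerSpace => x.1 (τ i.succ) - x.1 (τ i.castSucc) :=
      fun i => (hev _).sub (hev _)
    have : IsProbabilityMeasure (P.map Z) := Measure.isProbabilityMeasure_map hZ
    rw [iIndepFun_iff_map_fun_eq_pi_map (fun i => (hm i).aemeasurable),
      AEMeasurable.map_map_of_aemeasurable (measurable_pi_lambda _ hm).aemeasurable hZ]
    simp_rw [AEMeasurable.map_map_of_aemeasurable (hm _).aemeasurable hZ]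
    exact (iIndepFun_iff_map_fun_eq_pi_map (fun i => (hm i).comp_aemeasurable hZ)).1 h2

/-- The Wiener measure `W_σ` on the continuous functions on `[0,1]` vanishing at `0`; it exists by
the preceding theorem, and its finite-dimensional marginals determine it. -/
noncomputable def wienerMeasure (σ : ℝ) : Measure WienerSpace :=
  Classical.choose (exists_isWienerMeasure σ)

theorem isWienerMeasure_wienerMeasure (σ : ℝ) : IsWienerMeasure σ (wienerMeasure σ) :=
  Classical.choose_spec (exists_isWienerMeasure σ)

/-! ### The circle: continuous functions and the Brownian bridge -/

instance : MeasurableSpace C(UnitAddCircle, ℝ) := borel _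
instance : BorelSpace C(UnitAddCircle, ℝ) := ⟨rfl⟩

/-- Continuous functions on the circle `ℝ/ℤ` that vanish at `0`. -/
abbrev CircleWienerSpace : Type := {x : C(UnitAddCircle, ℝ) // x 0 = 0}

/-- The projection `y ↦ (t ↦ y t - t * y 1)`, `t ∈ [0,1)`, from the continuous functions on `[0,1]`
vanishing at `0` to the continuous functions on the circle vanishing at `0`. -/
noncomputable def bridgeProj (y : WienerSpace) : CircleWienerSpace :=
  ⟨⟨AddCircle.liftIco (1 : ℝ) 0
      (fun t : ℝ => y.1 (Set.projIcc 0 1 zero_le_one t) - t * y.1 1), by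
    refine AddCircle.liftIco_continuous ?_ (Continuous.continuousOn ?_)
    · rw [zero_add, Set.projIcc_left, Set.projIcc_right]
      have h0 := y.2
      change y.1 0 - 0 * y.1 1 = y.1 1 - 1 * y.1 1
      rw [h0]; ring
    · exact (y.1.continuous.comp continuous_projIcc).sub (continuous_id.mul continuous_const)⟩, by
    change AddCircle.liftIco (1 : ℝ) 0
      (fun t : ℝ => y.1 (Set.projIcc 0 1 zero_le_one t) - t * y.1 1) ((0 : ℝ) : UnitAddCircle) = 0
    rw [AddCircle.liftIco_zero_coe_apply (by simp), Set.projIcc_left]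
    have h0 := y.2
    change y.1 0 - 0 * y.1 1 = 0
    rw [h0]; ring⟩

theorem bridgeProj_coe (y : WienerSpace) (t : ℝ) (ht : t ∈ Set.Ico (0 : ℝ) 1) :
    (bridgeProj y).1 (t : UnitAddCircle) = y.1 ⟨t, ht.1, ht.2.le⟩ - t * y.1 1 := by
  change AddCircle.liftIco (1 : ℝ) 0
      (fun t : ℝ => y.1 (Set.projIcc 0 1 zero_le_one t) - t * y.1 1) (t : UnitAddCircle) = _
  rw [AddCircle.liftIco_zero_coe_apply ht, Set.projIcc_of_mem zero_le_one ⟨ht.1, ht.2.le⟩]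

theorem continuous_bridgeProj : Continuous bridgeProj := by
  refine LipschitzWith.continuous (K := 2) (LipschitzWith.of_dist_le_mul fun y z => ?_)
  rw [Subtype.dist_eq, ContinuousMap.dist_le (by positivity)]
  intro θ
  obtain ⟨t, ht, rfl⟩ : ∃ t ∈ Set.Ico (0 : ℝ) 1, (t : UnitAddCircle) = θ := by
    have := AddCircle.coe_image_Ico_eq (1 : ℝ) 0
    rw [zero_add] at this
    have h : θ ∈ (QuotientAddGroup.mk '' Set.Ico (0 : ℝ) 1 : Set (AddCircle (1 : ℝ))) := by
      rw [this]; trivial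
    exact h
  rw [bridgeProj_coe y t ht, bridgeProj_coe z t ht, Real.dist_eq]
  have h1 := ContinuousMap.dist_apply_le_dist (f := y.1) (g := z.1) ⟨t, ht.1, ht.2.le⟩
  have h2 := ContinuousMap.dist_apply_le_dist (f := y.1) (g := z.1) 1
  rw [Real.dist_eq] at h1 h2
  have h3 : |t * (y.1 1 - z.1 1)| ≤ dist y.1 z.1 := by
    rw [abs_mul, abs_of_nonneg ht.1]
    exact (mul_le_of_le_one_left (abs_nonneg _) ht.2.le).trans h2
  calc |y.1 ⟨t, ht.1, ht.2.le⟩ - t * y.1 1 - (z.1 ⟨t, ht.1, ht.2.le⟩ - t * z.1 1)|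
      = |(y.1 ⟨t, ht.1, ht.2.le⟩ - z.1 ⟨t, ht.1, ht.2.le⟩) - t * (y.1 1 - z.1 1)| := by
        congr 1; ring
    _ ≤ _ := abs_sub _ _
    _ ≤ dist y.1 z.1 + dist y.1 z.1 := add_le_add h1 h3
    _ = _ := by rw [NNReal.coe_ofNat, two_mul]; rfl

/-- The Wiener measure `W_{0,σ}` on the circle: the law of the Brownian bridge. -/
noncomputable def bridgeMeasure (σ : ℝ) : Measure CircleWienerSpace :=
  (wienerMeasure σ).map bridgeProj

/-! ### Diffeomorphisms of the circle -/

/-- `F` is a `C¹` lift of the circle map `f`, with positive derivative and degree one. -/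
structure IsC1Lift (F : ℝ → ℝ) (f : UnitAddCircle → UnitAddCircle) : Prop where
  contDiff : ContDiff ℝ 1 F
  deriv_pos : ∀ x, 0 < deriv F x
  map_add_one : ∀ x, F (x + 1) = F x + 1
  coe_eq : ∀ x : ℝ, f (x : UnitAddCircle) = (F x : UnitAddCircle)

namespace IsC1Lift

variable {F G : ℝ → ℝ} {f : UnitAddCircle → UnitAddCircle}

theorem strictMono (h : IsC1Lift F f) : StrictMono F := strictMono_of_deriv_pos h.deriv_pos

/-- A `C¹` lift as an element of Mathlib's type of degree one lifts. -/
def toCircleDeg1Lift (h : IsC1Lift F f) : CircleDeg1Lift :=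
  ⟨⟨F, h.strictMono.monotone⟩, h.map_add_one⟩

theorem continuous_deriv (h : IsC1Lift F f) : Continuous (deriv F) :=
  h.contDiff.continuous_deriv le_rfl

theorem periodic_deriv (h : IsC1Lift F f) : Function.Periodic (deriv F) 1 := by
  intro x
  have : (fun y => F (y + 1)) = fun y => F y + 1 := funext h.map_add_one
  have h2 := congrArg (fun g => deriv g x) this
  simpa [deriv_comp_add_const] using h2

theorem exists_int (hF : IsC1Lift F f) (hG : IsC1Lift G f) :
    ∃ n : ℤ, ∀ x, F x = G x + n := by
  have h1 : ∀ x, ∃ n : ℤ, F x - G x = n := by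
    intro x
    have := (hF.coe_eq x).symm.trans (hG.coe_eq x)
    rw [← sub_eq_zero, ← AddCircle.coe_sub, AddCircle.coe_eq_zero_iff] at this
    obtain ⟨n, hn⟩ := this
    exact ⟨n, by rw [← hn]; simp⟩
  choose n hn using h1
  have hc : Continuous n := by
    rw [Int.isClosedEmbedding_coe_real.isEmbedding.continuous_iff]
    have : ((fun m : ℤ => (m : ℝ)) ∘ n) = fun x => F x - G x := funext fun x => (hn x).symm
    rw [this]
    exact hF.contDiff.continuous.sub hG.contDiff.continuous
  refine ⟨n 0, fun x => ?_⟩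
  rw [PreconnectedSpace.constant inferInstance hc (x := 0) (y := x), ← hn]
  ring

theorem deriv_eq (hF : IsC1Lift F f) (hG : IsC1Lift G f) : deriv F = deriv G := by
  obtain ⟨n, hn⟩ := hF.exists_int hG
  rw [funext hn]
  funext x
  simp

end IsC1Lift

/-- Orientation preserving `C¹` diffeomorphisms of the circle `ℝ/ℤ`. -/
structure CircleDiffeo extends UnitAddCircle ≃ₜ UnitAddCircle where
  exists_lift : ∃ F : ℝ → ℝ, IsC1Lift F toFun

namespace CircleDiffeo

instance : FunLike CircleDiffeo UnitAddCircle UnitAddCircle where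
  coe f := f.toFun
  coe_injective f g h := by
    obtain ⟨f, hf⟩ := f
    obtain ⟨g, hg⟩ := g
    have : f = g := Homeomorph.ext fun x => congrFun h x
    subst this
    rfl

instance : ContinuousMapClass CircleDiffeo UnitAddCircle UnitAddCircle where
  map_continuous f := f.continuous_toFun

/-- A lift of `f` to the line. -/
noncomputable def lift (f : CircleDiffeo) : ℝ → ℝ := Classical.choose f.exists_lift

theorem isC1Lift_lift (f : CircleDiffeo) : IsC1Lift f.lift f := Classical.choose_spec f.exists_lift

/-- The derivative `f'`, as a continuous function on the circle. -/
noncomputable def derivative (f : CircleDiffeo) : C(UnitAddCircle, ℝ) :=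
  ⟨f.isC1Lift_lift.periodic_deriv.lift,
    f.isC1Lift_lift.continuous_deriv.quotient_lift _⟩

theorem derivative_coe (f : CircleDiffeo) {F : ℝ → ℝ} (hF : IsC1Lift F f) (t : ℝ) :
    f.derivative (t : UnitAddCircle) = deriv F t := by
  rw [hF.deriv_eq f.isC1Lift_lift]
  rfl

theorem derivative_pos (f : CircleDiffeo) (θ : UnitAddCircle) : 0 < f.derivative θ := by
  obtain ⟨t, rfl⟩ := QuotientAddGroup.mk_surjective θ
  exact f.isC1Lift_lift.deriv_pos t

/-- The rotation number of `f`: the translation number, modulo `1`, of a lift of `f`. -/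
noncomputable def rotationNumber (f : CircleDiffeo) : UnitAddCircle :=
  (f.isC1Lift_lift.toCircleDeg1Lift.translationNumber : UnitAddCircle)

/-- The `C¹` topology: uniform convergence of `f` and of `f'`. -/
noncomputable instance : TopologicalSpace CircleDiffeo :=
  TopologicalSpace.induced
    (fun f => ((f : C(UnitAddCircle, UnitAddCircle)), f.derivative)) inferInstance

noncomputable instance : MeasurableSpace CircleDiffeo := borel _
instance : BorelSpace CircleDiffeo := ⟨rfl⟩

/-- The diffeomorphism of the circle with a given `C¹` lift. -/
noncomputable def ofLift (F : ℝ → ℝ) (h1 : ContDiff ℝ 1 F) (h2 : ∀ x, 0 < deriv F x)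
    (h3 : ∀ x, F (x + 1) = F x + 1) : CircleDiffeo :=
  let g : CircleDeg1Lift := ⟨⟨F, (strictMono_of_deriv_pos h2).monotone⟩, h3⟩
  have hper : Function.Periodic (fun x => (F x : UnitAddCircle)) 1 := fun x => by
    simp only [h3, AddCircle.coe_add, AddCircle.coe_period, add_zero]
  have hcont : Continuous hper.lift :=
    Continuous.quotient_lift ((AddCircle.continuous_mk' 1).comp h1.continuous) _
  have hbij : Function.Bijective hper.lift := by
    constructor
    · intro a b
      obtain ⟨x, rfl⟩ := QuotientAddGroup.mk_surjective a
      obtain ⟨y, rfl⟩ := QuotientAddGroup.mk_surjective b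
      intro h
      change (F x : UnitAddCircle) = (F y : UnitAddCircle) at h
      rw [← sub_eq_zero, ← AddCircle.coe_sub, AddCircle.coe_eq_zero_iff] at h
      obtain ⟨n, hn⟩ := h
      have h4 : F x = F (y + n) := by
        have := g.map_add_int y n
        change F (y + n) = F y + n at this
        rw [this]
        simp at hn
        linarith
      rw [(strictMono_of_deriv_pos h2).injective h4]
      change ((y + n : ℝ) : UnitAddCircle) = (y : UnitAddCircle)
      rw [← sub_eq_zero, ← AddCircle.coe_sub, AddCircle.coe_eq_zero_iff]
      exact ⟨n, by simp⟩
    · intro b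
      obtain ⟨y, rfl⟩ := QuotientAddGroup.mk_surjective b
      obtain ⟨x, hx⟩ := g.continuous_iff_surjective.1 h1.continuous y
      exact ⟨(x : UnitAddCircle), congrArg _ hx⟩
  { toHomeomorph := Continuous.homeoOfEquivCompactToT2 (f := Equiv.ofBijective _ hbij) hcont
    exists_lift := ⟨F, h1, h2, h3, fun _ => rfl⟩ }

theorem isC1Lift_ofLift (F : ℝ → ℝ) (h1 : ContDiff ℝ 1 F) (h2 : ∀ x, 0 < deriv F x)
    (h3 : ∀ x, F (x + 1) = F x + 1) : IsC1Lift F (ofLift F h1 h2 h3) :=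
  ⟨h1, h2, h3, fun _ => rfl⟩

end CircleDiffeo

namespace CircleDiffeo

theorem ext {f g : CircleDiffeo} (h : ∀ t : ℝ, f (t : UnitAddCircle) = g (t : UnitAddCircle)) :
    f = g :=
  DFunLike.ext f g fun θ => by
    obtain ⟨t, rfl⟩ := QuotientAddGroup.mk_surjective θ
    exact h t

/-- The mean value `∫₀¹ e^{x(s)} ds`. -/
noncomputable def expMean (x : CircleWienerSpace) : ℝ :=
  ∫ s in (0 : ℝ)..1, Real.exp (x.1 (s : UnitAddCircle))

theorem continuous_exp_coe (x : CircleWienerSpace) :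
    Continuous fun s : ℝ => Real.exp (x.1 (s : UnitAddCircle)) :=
  Real.continuous_exp.comp (x.1.continuous.comp (AddCircle.continuous_mk' 1))

theorem expMean_pos (x : CircleWienerSpace) : 0 < expMean x :=
  intervalIntegral.intervalIntegral_pos_of_pos
    ((continuous_exp_coe x).intervalIntegrable _ _) (fun _ => Real.exp_pos _) one_pos

/-- The lift `t ↦ c(x) ∫₀ᵗ e^{x(s)} ds + a`, with `c(x) = (∫₀¹ e^{x(s)} ds)⁻¹`. -/
noncomputable def primitive (x : CircleWienerSpace) (a : ℝ) (t : ℝ) : ℝ :=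
  (expMean x)⁻¹ * (∫ s in (0 : ℝ)..t, Real.exp (x.1 (s : UnitAddCircle))) + a

theorem hasDerivAt_primitive (x : CircleWienerSpace) (a t : ℝ) :
    HasDerivAt (primitive x a) ((expMean x)⁻¹ * Real.exp (x.1 (t : UnitAddCircle))) t :=
  ((intervalIntegral.integral_hasDerivAt_right ((continuous_exp_coe x).intervalIntegrable _ _)
    ((continuous_exp_coe x).stronglyMeasurableAtFilter _ _)
    (continuous_exp_coe x).continuousAt).const_mul _).add_const a

theorem deriv_primitive (x : CircleWienerSpace) (a : ℝ) :
    deriv (primitive x a) = fun t : ℝ => (expMean x)⁻¹ * Real.exp (x.1 (t : UnitAddCircle)) :=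
  funext fun t => (hasDerivAt_primitive x a t).deriv

theorem contDiff_primitive (x : CircleWienerSpace) (a : ℝ) : ContDiff ℝ 1 (primitive x a) := by
  rw [contDiff_one_iff_deriv]
  refine ⟨fun t => (hasDerivAt_primitive x a t).differentiableAt, ?_⟩
  rw [deriv_primitive]
  exact continuous_const.mul (continuous_exp_coe x)

theorem deriv_primitive_pos (x : CircleWienerSpace) (a t : ℝ) : 0 < deriv (primitive x a) t := by
  rw [deriv_primitive]
  exact mul_pos (inv_pos.2 (expMean_pos x)) (Real.exp_pos _)

theorem primitive_add_one (x : CircleWienerSpace) (a t : ℝ) :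
    primitive x a (t + 1) = primitive x a t + 1 := by
  have hper : Function.Periodic (fun s : ℝ => Real.exp (x.1 (s : UnitAddCircle))) 1 := fun s => by
    simp only [AddCircle.coe_add, AddCircle.coe_period, add_zero]
  have hi := fun a b : ℝ => (continuous_exp_coe x).intervalIntegrable (μ := volume) a b
  have h1 := intervalIntegral.integral_add_adjacent_intervals (hi 0 t) (hi t (t + 1))
  have h2 := hper.intervalIntegral_add_eq t 0
  rw [zero_add] at h2
  rw [h2] at h1
  unfold primitive
  rw [← h1]
  change _ * (_ + expMean x) + a = _
  rw [mul_add, inv_mul_cancel₀ (expMean_pos x).ne']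
  ring

/-- The logarithmic derivative `log f' - log f'(0)`. -/
noncomputable def logDeriv (f : CircleDiffeo) : CircleWienerSpace :=
  ⟨⟨fun θ => Real.log (f.derivative θ) - Real.log (f.derivative 0),
    (f.derivative.continuous.log fun θ => (f.derivative_pos θ).ne').sub continuous_const⟩,
    sub_self _⟩

/-- The diffeomorphism `t ↦ c(x) ∫₀ᵗ e^{x(s)} ds + a` of the circle. -/
noncomputable def ofLogDeriv (p : CircleWienerSpace × UnitAddCircle) : CircleDiffeo :=
  ofLift (primitive p.1 (AddCircle.equivIco 1 0 p.2)) (contDiff_primitive _ _)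
    (deriv_primitive_pos _ _) (primitive_add_one _ _)

theorem ofLogDeriv_coe (x : CircleWienerSpace) (a : UnitAddCircle) (t : ℝ) :
    ofLogDeriv (x, a) (t : UnitAddCircle) =
      (((expMean x)⁻¹ * ∫ s in (0 : ℝ)..t, Real.exp (x.1 (s : UnitAddCircle)) : ℝ) :
        UnitAddCircle) + a := by
  change ((primitive x (AddCircle.equivIco 1 0 a) t : ℝ) : UnitAddCircle) = _
  unfold primitive
  rw [AddCircle.coe_add, AddCircle.coe_equivIco]

theorem derivative_ofLogDeriv (x : CircleWienerSpace) (a θ : UnitAddCircle) :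
    (ofLogDeriv (x, a)).derivative θ = (expMean x)⁻¹ * Real.exp (x.1 θ) := by
  obtain ⟨t, rfl⟩ := QuotientAddGroup.mk_surjective θ
  have h := derivative_coe (ofLogDeriv (x, a)) (isC1Lift_ofLift _ _ _ _) t
  rw [deriv_primitive] at h
  exact h

theorem continuous_expMean : Continuous expMean := by
  refine intervalIntegral.continuous_parametric_intervalIntegral_of_continuous' ?_ 0 1
  have : Continuous fun p : CircleWienerSpace × UnitAddCircle => p.1.1 p.2 := by fun_prop
  exact Real.continuous_exp.comp
    (this.comp (continuous_fst.prodMk ((AddCircle.continuous_mk' 1).comp continuous_snd)))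

/-- `f ↦ (log f' - log f'(0), f(0))` is a homeomorphism from the `C¹` diffeomorphisms of the circle
onto `C₀(𝕋) × 𝕋`, with inverse `(x, a) ↦ (t ↦ c(x) ∫₀ᵗ e^{x(s)} ds + a)`. -/
noncomputable def logDerivHomeomorph : CircleDiffeo ≃ₜ CircleWienerSpace × UnitAddCircle where
  toFun f := (logDeriv f, f 0)
  invFun := ofLogDeriv
  left_inv f := by
    refine CircleDiffeo.ext fun t => ?_
    have hF := f.isC1Lift_lift
    set F := f.lift
    have h0 : 0 < deriv F 0 := hF.deriv_pos 0
    have he : ∀ s : ℝ, Real.exp ((logDeriv f).1 (s : UnitAddCircle)) = (deriv F 0)⁻¹ * deriv F s := by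
      intro s
      change Real.exp (Real.log (f.derivative (s : UnitAddCircle))
        - Real.log (f.derivative ((0 : ℝ) : UnitAddCircle))) = _
      rw [derivative_coe f hF, derivative_coe f hF, Real.exp_sub, Real.exp_log (hF.deriv_pos s),
        Real.exp_log h0, div_eq_inv_mul]
    have hI : ∀ r : ℝ, ∫ s in (0 : ℝ)..r, Real.exp ((logDeriv f).1 (s : UnitAddCircle))
        = (deriv F 0)⁻¹ * (F r - F 0) := by
      intro r
      simp_rw [he]
      rw [intervalIntegral.integral_const_mul, intervalIntegral.integral_deriv_eq_sub
        (fun s _ => hF.contDiff.differentiable one_ne_zero s)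
        (hF.continuous_deriv.intervalIntegrable _ _)]
    have h1 : expMean (logDeriv f) = (deriv F 0)⁻¹ := by
      unfold expMean
      have := hF.map_add_one 0
      rw [zero_add] at this
      rw [hI, this]; ring
    rw [ofLogDeriv_coe, h1, hI, inv_inv, ← mul_assoc, mul_inv_cancel₀ h0.ne', one_mul,
      AddCircle.coe_sub, ← hF.coe_eq, ← hF.coe_eq]
    exact sub_add_cancel _ _
  right_inv := by
    rintro ⟨x, a⟩
    refine Prod.ext (Subtype.ext (ContinuousMap.ext fun θ => ?_)) ?_
    · change Real.log ((ofLogDeriv (x, a)).derivative θ)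
        - Real.log ((ofLogDeriv (x, a)).derivative 0) = x.1 θ
      have hc := (inv_pos.2 (expMean_pos x)).ne'
      rw [derivative_ofLogDeriv, derivative_ofLogDeriv, Real.log_mul hc (Real.exp_pos _).ne',
        Real.log_mul hc (Real.exp_pos _).ne', Real.log_exp, Real.log_exp, x.2]
      ring
    · change ofLogDeriv (x, a) ((0 : ℝ) : UnitAddCircle) = a
      rw [ofLogDeriv_coe]
      simp
  continuous_toFun := by
    have hind : Continuous fun f : CircleDiffeo =>
        ((f : C(UnitAddCircle, UnitAddCircle)), f.derivative) := continuous_induced_dom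
    have h1 : Continuous fun p : CircleDiffeo × UnitAddCircle => p.1.derivative p.2 :=
      continuous_eval.comp ((continuous_snd.comp (hind.comp continuous_fst)).prodMk continuous_snd)
    have h2 : Continuous fun f : CircleDiffeo => f 0 :=
      (continuous_eval_const (F := C(UnitAddCircle, UnitAddCircle)) 0).comp
        (continuous_fst.comp hind)
    have h3 : Continuous fun p : CircleDiffeo × UnitAddCircle => Real.log (p.1.derivative p.2) :=
      h1.log fun p => (p.1.derivative_pos p.2).ne'
    refine (Continuous.subtype_mk (ContinuousMap.continuous_of_continuous_uncurry _ ?_) _).prodMk h2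
    exact h3.sub (h3.comp (continuous_fst.prodMk continuous_const))
  continuous_invFun := by
    rw [continuous_induced_rng]
    refine Continuous.prodMk ?_ ?_
    · refine ContinuousMap.continuous_of_continuous_uncurry _ ?_
      have hq : IsOpenQuotientMap (Prod.map (id : CircleWienerSpace × UnitAddCircle → _)
          (fun t : ℝ => (t : UnitAddCircle))) :=
        IsOpenQuotientMap.id.prodMap QuotientAddGroup.isOpenQuotientMap_mk
      rw [hq.isQuotientMap.continuous_iff]
      have hint : Continuous fun p : (CircleWienerSpace × UnitAddCircle) × ℝ =>
          ∫ s in (0 : ℝ)..p.2, Real.exp (p.1.1.1 (s : UnitAddCircle)) := by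
        refine intervalIntegral.continuous_parametric_primitive_of_continuous
          (f := fun (p : CircleWienerSpace × UnitAddCircle) (s : ℝ) =>
            Real.exp (p.1.1 (s : UnitAddCircle))) ?_
        have : Continuous fun p : CircleWienerSpace × UnitAddCircle => p.1.1 p.2 := by fun_prop
        exact Real.continuous_exp.comp (this.comp ((continuous_fst.comp continuous_fst).prodMk
          ((AddCircle.continuous_mk' 1).comp continuous_snd)))
      have : Continuous fun p : (CircleWienerSpace × UnitAddCircle) × ℝ =>
          ((((expMean p.1.1)⁻¹ * ∫ s in (0 : ℝ)..p.2, Real.exp (p.1.1.1 (s : UnitAddCircle)) : ℝ) :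
        UnitAddCircle) + p.1.2) :=
        ((AddCircle.continuous_mk' 1).comp
          (((continuous_expMean.comp (continuous_fst.comp continuous_fst)).inv₀
            fun p => (expMean_pos _).ne').mul hint)).add (continuous_snd.comp continuous_fst)
      refine this.congr fun p => ?_
      exact (ofLogDeriv_coe p.1.1 p.1.2 p.2).symm
    · refine ContinuousMap.continuous_of_continuous_uncurry _ ?_
      have h1 : Continuous fun p : (CircleWienerSpace × UnitAddCircle) × UnitAddCircle =>
          (expMean p.1.1)⁻¹ * Real.exp (p.1.1.1 p.2) := by
        refine ((continuous_expMean.comp (continuous_fst.comp continuous_fst)).inv₀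
            fun p => (expMean_pos _).ne').mul (Real.continuous_exp.comp ?_)
        fun_prop
      exact h1.congr fun p => (derivative_ofLogDeriv p.1.1 p.1.2 p.2).symm

end CircleDiffeo

/-! ### The Malliavin-Shavgulidze measures -/

/-- The Malliavin-Shavgulidze measure `μ_σ` on the `C¹` diffeomorphisms of the circle: the image of
`W_{0,σ} ⊗ Leb` under `(x, a) ↦ (t ↦ c(x) ∫₀ᵗ e^{x(s)} ds + a)`. -/
noncomputable def malliavinShavgulidze (σ : ℝ) : Measure CircleDiffeo :=
  ((bridgeMeasure σ).prod (volume : Measure UnitAddCircle)).map CircleDiffeo.logDerivHomeomorph.symm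

instance (σ : ℝ) : IsProbabilityMeasure (malliavinShavgulidze σ) := by
  have h1 : IsProbabilityMeasure (wienerMeasure σ) :=
    (isWienerMeasure_wienerMeasure σ).isProbabilityMeasure
  have h2 : IsProbabilityMeasure (bridgeMeasure σ) :=
    Measure.isProbabilityMeasure_map continuous_bridgeProj.measurable.aemeasurable
  have h3 : IsProbabilityMeasure (volume : Measure UnitAddCircle) :=
    ⟨by rw [AddCircle.measure_univ, ENNReal.ofReal_one]⟩
  exact Measure.isProbabilityMeasure_map
    CircleDiffeo.logDerivHomeomorph.symm.continuous.measurable.aemeasurable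

theorem CircleDiffeo.rotationNumber_eq (f : CircleDiffeo) {F : ℝ → ℝ} (hF : IsC1Lift F f) :
    f.rotationNumber = (hF.toCircleDeg1Lift.translationNumber : UnitAddCircle) := by
  obtain ⟨n, hn⟩ := hF.exists_int f.isC1Lift_lift
  let T : CircleDeg1Liftˣ := CircleDeg1Lift.translate (Multiplicative.ofAdd (n : ℝ))
  have h1 : hF.toCircleDeg1Lift = T * f.isC1Lift_lift.toCircleDeg1Lift := by
    ext x
    rw [CircleDeg1Lift.mul_apply, CircleDeg1Lift.translate_apply]
    exact (hn x).trans (add_comm _ _)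
  have h2 : Commute (T : CircleDeg1Lift) f.isC1Lift_lift.toCircleDeg1Lift := by
    rw [CircleDeg1Lift.commute_iff_commute]
    intro x
    rw [CircleDeg1Lift.translate_apply, CircleDeg1Lift.translate_apply,
      CircleDeg1Lift.map_int_add]
  rw [h1, CircleDeg1Lift.translationNumber_mul_of_commute h2,
    CircleDeg1Lift.translationNumber_translate, AddCircle.coe_add, rotationNumber]
  have : ((n : ℝ) : UnitAddCircle) = 0 := (AddCircle.coe_eq_zero_iff 1).2 ⟨n, by simp⟩
  rw [this, zero_add]

/-! ### Translation numbers of pairs of lifts at positive distance -/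

/-! Fix the logarithmic derivative $x$ and let only the additive constant $a$ vary: this is
composition with rotations. The standard lifts $F_a=F_0+a$ have a translation number $\tau(F_a)$
which is nondecreasing in $a$. It may be constant on an interval at a rational value (mode locking),
but it takes each irrational value at most once. Hence for each $x$ only countably many $a\in\mathbb
T$ give rotation number $\alpha$ mod 1, at most one for each real representative $\alpha+n$. Under
$\mu_\sigma$ the parameter $a$ is Lebesgue distributed and independent of $x$, so Fubini finishes
the proof; the law of $x$ plays no part.

The dynamical core is `not_irrational_translationNumber_of_add_le`. Suppose $f+\delta\le g$ with
common irrational translation number $\tau$. By Dirichlet some $k\ge 1$ and $j$ satisfy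
$|k\tau-j|<\delta$. The iterates still satisfy $f^k+\delta\le g^k$ (`pow_add_le_pow`), and both have
translation number $k\tau\ne j$. A gap of $\delta$ is wide enough to push one of them across the
integer translation by $j$ at some point, and this puts its translation number on the wrong side of
$j$.

The remaining ingredient is measurability of the event, so that null sections give a null set: the
translation number is a pointwise limit of the continuous functions $F^n(0)/n$ of $(x,a)$
(`measurable_translationNumber_primitiveLift`). -/

namespace CircleDeg1Lift

/-- Iterating does not shrink the gap: the last application of $g$ instead of $f$ already creates
the whole $\delta$, and by monotonicity the earlier ones can only help. For the zeroth power both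
sides are the identity and there is no gap. -/
theorem pow_add_le_pow {f g : CircleDeg1Lift} {δ : ℝ} (hδ : 0 ≤ δ) (h : ∀ x, f x + δ ≤ g x)
    {n : ℕ} (hn : n ≠ 0) (x : ℝ) : (f ^ n) x + δ ≤ (g ^ n) x := by
  obtain ⟨m, rfl⟩ := Nat.exists_eq_succ_of_ne_zero hn
  have hle : f ≤ g := fun y => (le_add_of_nonneg_right hδ).trans (h y)
  rw [Nat.succ_eq_add_one, pow_succ', pow_succ', mul_apply, mul_apply]
  have hm : (f ^ m) x ≤ (g ^ m) x := by
    rw [coe_pow, coe_pow]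
    exact f.monotone.iterate_le_of_le hle m x
  linarith [f.monotone hm, h ((g ^ m) x)]

/-- Two lifts at positive distance, one above the other, do not share an irrational translation
number. -/
theorem not_irrational_translationNumber_of_add_le {f g : CircleDeg1Lift} {δ : ℝ} (hδ : 0 < δ)
    (h : ∀ x, f x + δ ≤ g x) (hfg : translationNumber f = translationNumber g) :
    ¬ Irrational (translationNumber f) := by
  intro hirr
  obtain ⟨N, hN⟩ := exists_nat_one_div_lt hδ
  -- Dirichlet approximation at level $N+1$ gives the error bound $1/(N+2)$, which is below
  -- $1/(N+1)<\delta$.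
  obtain ⟨j, k, hk, -, hjk⟩ :=
    Real.exists_int_int_abs_mul_sub_le (translationNumber f) (Nat.succ_pos N)
  lift k to ℕ using hk.le
  have hk' : k ≠ 0 := by rintro rfl; exact hk.ne rfl
  have hdist : |(k : ℝ) * translationNumber f - j| < δ := by
    refine hjk.trans_lt (lt_of_le_of_lt ?_ hN)
    push_cast
    gcongr
    linarith
  rw [abs_lt] at hdist
  have hf := translationNumber_pow f k
  have hg := translationNumber_pow g k
  rw [← hfg] at hg
  have hpow := pow_add_le_pow hδ.le h hk'
  -- Irrationality enters here: $k\tau\ne j$. The two cases are mirror images, with $f$ and $g$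
  -- exchanged.
  rcases lt_or_gt_of_ne ((hirr.natCast_mul hk').ne_int j) with hlt | hlt
  -- Since $j-\delta<k\tau$, the map $f^k$ cannot lie below translation by $j-\delta$ everywhere. At
  -- a point where it exceeds it, the gap lifts $g^k$ to at least $x+j$, which forces $k\tau\ge j$.
  · obtain ⟨x, hx⟩ : ∃ x, x + (j - δ) < (f ^ k) x := by
      by_contra! hc
      linarith [translationNumber_le_of_le_add _ hc]
    have := le_translationNumber_of_add_int_le (g ^ k) (x := x) (m := j) (by linarith [hpow x])
    linarith
  -- Now $k\tau<j+\delta$ yields a point where $g^k$ is below translation by $j+\delta$; there $f^k$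
  -- is at most $x+j$, which forces $k\tau\le j$.
  · obtain ⟨x, hx⟩ : ∃ x, (g ^ k) x < x + (j + δ) := by
      by_contra! hc
      linarith [le_translationNumber_of_add_le _ hc]
    have := translationNumber_le_of_le_add_int (f ^ k) (x := x) (m := j) (by linarith [hpow x])
    linarith

end CircleDeg1Lift

/-! ### The translation number of the standard lift -/

namespace CircleDiffeo

/-- The lift `t ↦ c(x) ∫₀ᵗ e^{x(s)} ds + a` as a degree one lift. -/
noncomputable def primitiveLift (x : CircleWienerSpace) (a : ℝ) : CircleDeg1Lift :=
  ⟨⟨primitive x a, (strictMono_of_deriv_pos (deriv_primitive_pos x a)).monotone⟩,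
    primitive_add_one x a⟩

theorem primitiveLift_apply (x : CircleWienerSpace) (a t : ℝ) :
    primitiveLift x a t = primitive x a t := rfl

/-- The rotation number does not depend on the lift, so the chosen lift can be traded for the
explicit one, with $a$ represented in $[0,1)$. -/
theorem rotationNumber_ofLogDeriv (p : CircleWienerSpace × UnitAddCircle) :
    (ofLogDeriv p).rotationNumber =
      ((primitiveLift p.1 (AddCircle.equivIco 1 0 p.2)).translationNumber : UnitAddCircle) :=
  rotationNumber_eq _ (isC1Lift_ofLift _ _ _ _)

/-- With $x$ fixed, two standard lifts differ by the constant $b-a$, so distinct parameters are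
separated by a uniform gap $\delta=|b-a|$. -/
theorem eq_of_irrational_translationNumber_primitiveLift {x : CircleWienerSpace} {a b : ℝ}
    (hirr : Irrational (primitiveLift x a).translationNumber)
    (hab : (primitiveLift x a).translationNumber = (primitiveLift x b).translationNumber) :
    a = b := by
  have key : ∀ c d : ℝ, c < d →
      (primitiveLift x c).translationNumber = (primitiveLift x d).translationNumber →
      ¬ Irrational (primitiveLift x c).translationNumber := fun c d hcd h =>
    CircleDeg1Lift.not_irrational_translationNumber_of_add_le (sub_pos.2 hcd)
      (fun t => by rw [primitiveLift_apply, primitiveLift_apply, primitive, primitive]; linarith) h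
  rcases lt_trichotomy a b with h | h | h
  · exact absurd hirr (key a b h hab)
  · exact h
  · exact absurd (hab ▸ hirr) (key b a h hab.symm)

/-! ### Measurability of the rotation number in $(x,a)$. -/

/-- Continuity in $t$ jointly with $(x,a)$ is needed because, in the iterates, $t$ is replaced by a
point that itself depends on $(x,a)$. -/
theorem continuous_primitive :
    Continuous fun q : (CircleWienerSpace × ℝ) × ℝ => primitive q.1.1 q.1.2 q.2 := by
  have hint : Continuous fun q : (CircleWienerSpace × ℝ) × ℝ =>
      ∫ s in (0 : ℝ)..q.2, Real.exp (q.1.1.1 (s : UnitAddCircle)) := by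
    refine intervalIntegral.continuous_parametric_primitive_of_continuous
      (f := fun (q : CircleWienerSpace × ℝ) (s : ℝ) => Real.exp (q.1.1 (s : UnitAddCircle))) ?_
    have : Continuous fun q : CircleWienerSpace × UnitAddCircle => q.1.1 q.2 := by fun_prop
    exact Real.continuous_exp.comp (this.comp ((continuous_fst.comp continuous_fst).prodMk
      ((AddCircle.continuous_mk' 1).comp continuous_snd)))
  exact (((continuous_expMean.comp (continuous_fst.comp continuous_fst)).inv₀
    fun q => (expMean_pos _).ne').mul hint).add (continuous_snd.comp continuous_fst)

theorem measurable_translationNumber_primitiveLift :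
    Measurable fun q : CircleWienerSpace × ℝ => (primitiveLift q.1 q.2).translationNumber := by
  have hiter : ∀ n : ℕ,
      Continuous fun q : CircleWienerSpace × ℝ => (primitive q.1 q.2)^[n] 0 := by
    intro n
    induction n with
    | zero => exact continuous_const
    | succ n ih =>
      simp_rw [Function.iterate_succ_apply']
      exact continuous_primitive.comp (continuous_id.prodMk ih)
  -- Continuity of the translation number is not needed: a pointwise limit of the continuous
  -- functions $F^n(0)/n$ is Borel.
  refine measurable_of_tendsto_metrizable
    (f := fun (n : ℕ) (q : CircleWienerSpace × ℝ) => (primitive q.1 q.2)^[n] 0 / n)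
    (fun n => (hiter n).measurable.div_const _) (tendsto_pi_nhds.2 fun q => ?_)
  refine (primitiveLift q.1 q.2).tendsto_translation_number₀.congr fun n => ?_
  rw [CircleDeg1Lift.coe_pow]
  rfl

theorem measurable_rotationNumber_ofLogDeriv :
    Measurable fun p : CircleWienerSpace × UnitAddCircle => (ofLogDeriv p).rotationNumber := by
  -- The representative in $[0,1)$ jumps at $0\in\mathbb T$, so it is measurable but not continuous.
  have hrep : Measurable fun a : UnitAddCircle => (AddCircle.equivIco (1 : ℝ) 0 a : ℝ) :=
    measurable_subtype_coe.comp (AddCircle.measurableEquivIco (1 : ℝ) 0).measurable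
  have hpair : Measurable fun p : CircleWienerSpace × UnitAddCircle =>
      (p.1, (AddCircle.equivIco (1 : ℝ) 0 p.2 : ℝ)) :=
    measurable_fst.prodMk (hrep.comp measurable_snd)
  have hτ := measurable_translationNumber_primitiveLift.comp hpair
  have hcoe : Measurable fun t : ℝ => (t : UnitAddCircle) := (AddCircle.continuous_mk' 1).measurable
  rw [funext rotationNumber_ofLogDeriv]
  exact hcoe.comp hτ

/-! ### Null fibres and Fubini. -/

/-- Rotation number $\alpha$ mod 1 means that the translation number of the standard lift is
$\alpha+n$ for some integer $n$. Each $\alpha+n$ is irrational, hence is attained by at most one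
parameter. -/
theorem countable_setOf_rotationNumber_ofLogDeriv_eq (x : CircleWienerSpace) {α : ℝ}
    (hα : Irrational α) :
    {a : UnitAddCircle | (ofLogDeriv (x, a)).rotationNumber = (α : UnitAddCircle)}.Countable := by
  refine (Set.countable_iUnion fun n : ℤ => Set.Subsingleton.countable (s := {a : UnitAddCircle |
    (primitiveLift x (AddCircle.equivIco 1 0 a)).translationNumber = α + n}) ?_).mono ?_
  -- Injectivity is proved for real parameters; it descends to the circle because representatives in
  -- $[0,1)$ are unique.
  · intro a ha b hb
    refine (AddCircle.equivIco 1 0).injective (Subtype.ext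
      (eq_of_irrational_translationNumber_primitiveLift (x := x) ?_ (ha.trans hb.symm)))
    rw [Set.mem_ofPred_eq] at ha
    rw [ha]
    exact hα.add_intCast n
  · intro a ha
    rw [Set.mem_ofPred_eq, rotationNumber_ofLogDeriv, ← sub_eq_zero, ← AddCircle.coe_sub,
      AddCircle.coe_eq_zero_iff] at ha
    obtain ⟨n, hn⟩ := ha
    refine Set.mem_iUnion.2 ⟨n, ?_⟩
    rw [zsmul_eq_mul, mul_one] at hn
    rw [Set.mem_ofPred_eq, hn]
    ring

end CircleDiffeo

instance : NullSingletonClass (volume : Measure UnitAddCircle) where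
  measure_singleton a := by
    -- A point is a closed ball of radius $0$, and the volume of a ball on the circle is explicit.
    rw [← Metric.closedBall_zero, AddCircle.volume_closedBall]
    simp

theorem mainTheorem6 (σ : ℝ) (hσ : 0 < σ) (α : ℝ) (hα : Irrational α) :
    malliavinShavgulidze σ
      {f : CircleDiffeo | f.rotationNumber = (α : UnitAddCircle)} = 0 := by
  have hmap := CircleDiffeo.logDerivHomeomorph.symm.toMeasurableEquiv.map_apply
    (μ := (bridgeMeasure σ).prod (volume : Measure UnitAddCircle))
    {f : CircleDiffeo | f.rotationNumber = (α : UnitAddCircle)}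
  -- Pulled back to $C_0(\mathbb T)\times\mathbb T$, the event has a section over every $x$, not
  -- just almost every one, that is countable and hence Lebesgue null.
  refine hmap.trans (Measure.measure_prod_null_of_ae_null ?_ (ae_of_all _ fun x => ?_))
  · exact CircleDiffeo.measurable_rotationNumber_ofLogDeriv (measurableSet_singleton _)
  · exact (CircleDiffeo.countable_setOf_rotationNumber_ofLogDeriv_eq x hα).measure_zero _
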